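/- Consider a connected circuit, i.e. a finite connected directed multigraph with a chosen reference node and reduced incidence matrix $A$, whose branches are capacitors ($c$), memcapacitors ($mc$), inductors ($l$), meminductors ($ml$), current-controlled resistors ($r$), voltage-controlled resistors ($g$), $q$-memristors ($m$), $\varphi$-memristors ($w$), current-controlled hybrid memristors ($hm$), voltage-controlled hybrid memristors ($hw$), voltage sources ($u$) and current sources ($j$); $A_k$ denotes the columns of $A$ that correspond to the devices of type $k$. With $C^1$ maps $\gamma_c,\gamma_l,\gamma_r,\gamma_g,\eta,\zeta,\omega,\theta,\psi,\xi$ and excitations $v_s(t)$, $i_s(t)$, the nodal model of the circuit is $$q_c'=i_c,\ q_{mc}'=i_{mc},\ \varphi_l'=A_l^Te,\ \varphi_{ml}'=A_{ml}^Te,\ q_m'=i_m,\ q_{ml}'=i_{ml},\ q_{hm}'=i_{hm},\ q_{hw}'=i_{hw},$$ $$\varphi_w'=A_w^Te,\ \varphi_{mc}'=A_{mc}^Te,\ \varphi_{hm}'=A_{hm}^Te,\ \varphi_{hw}'=A_{hw}^Te,$$ $$0=A_ci_c+A_{mc}i_{mc}+A_ui_u+A_li_l+A_{ml}i_{ml}+A_g\gamma_g(A_g^Te)+A_w\zeta(\varphi_w,A_w^Te)+A_ri_r+A_mi_m+A_{hm}i_{hm}+A_{hw}i_{hw}+A_ji_s(t),$$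 $$0=q_c-\gamma_c(A_c^Te),\quad 0=q_{mc}-\omega(\varphi_{mc},A_{mc}^Te),\quad 0=v_s(t)-A_u^Te,\quad 0=\varphi_l-\gamma_l(i_l),\quad 0=\varphi_{ml}-\theta(q_{ml},i_{ml}),$$ $$0=\gamma_r(i_r)-A_r^Te,\quad 0=\eta(q_m,i_m)-A_m^Te,\quad 0=\psi(q_{hm},\varphi_{hm},i_{hm})-A_{hm}^Te,\quad 0=i_{hw}-\xi(q_{hw},\varphi_{hw},A_{hw}^Te).$$ Write it as $Ez'=f(z,t)$, where $z$ collects the dynamic variables (those that appear differentiated) and then the algebraic ones ($e$ and the branch currents), $E=\text{block-diag}(I,0)$, and let $F=f_z$. Assume that the circuit is well-posed, in the sense that it has no loop formed only by voltage sources and no cutset formed only by current sources, and that it is topologically degenerate: it has a loop formed by voltage sources, capacitors and/or memcapacitors, or a cutset formed by current sources, inductors and/or meminductors. Assume that at every point $z$ of a set $\Omega$ (for instance, the whole space) the incremental matrices $C=\gamma_c'$, $C_{\mathrm m}=\omega_{v_{mc}}$, $L=\gamma_l'$, $L_{\mathrm m}=\theta_{i_{ml}}$, $R=\gamma_r'$,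 $G=\gamma_g'$, $M=\eta_{i_m}$, $M_{\mathrm h}=\psi_{i_{hm}}$, $W=\zeta_{v_w}$, $W_{\mathrm h}=\xi_{v_{hw}}$ are positive definite, where a real, not necessarily symmetric, matrix $K$ is positive definite if $u^TKu>0$ for all real $u\neq 0$. Then the nodal model has tractability index two on $\Omega$. That is, for any projector $Q$ onto $\ker E$ and for all $z\in\Omega$ and all $t$, the matrix $E_1=E-FQ$ is singular and, for any projector $Q_1$ onto $\ker E_1$, the matrix $E_2=E_1-F(I-Q)Q_1$ is nonsingular; moreover, $\ker E_1(z,t)$ admits a projector $Q_1(z,t)$ that is continuous on $\Omega\times\mathbb{R}$. -/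

import Mathlib

/-! ### Matrices, projectors and the tractability index -/

/-- A (not necessarily symmetric) real square matrix `K` is positive definite if
`uᵀ K u > 0` for every nonzero real vector `u`. -/
def IsPositiveDefinite {n : Type*} [Fintype n] (K : Matrix n n ℝ) : Prop :=
  ∀ u : n → ℝ, u ≠ 0 → 0 < u ⬝ᵥ (K.mulVec u)

/-- The kernel of a matrix. -/
def matrixKer {n : Type*} [Fintype n] (M : Matrix n n ℝ) : Submodule ℝ (n → ℝ) :=
  LinearMap.ker M.mulVecLin

/-- `P` is a projector (idempotent matrix) whose image is the subspace `S`. -/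
def IsProjectorOnto {n : Type*} [Fintype n] (P : Matrix n n ℝ)
    (S : Submodule ℝ (n → ℝ)) : Prop :=
  P * P = P ∧ LinearMap.range P.mulVecLin = S

/-- The matrix of partial derivatives of `g` at `x`. -/
noncomputable def jacobian {m n : Type*} [Fintype m] [Fintype n] [DecidableEq n]
    (g : (n → ℝ) → (m → ℝ)) (x : n → ℝ) : Matrix m n ℝ :=
  LinearMap.toMatrix' (fderiv ℝ g x : (n → ℝ) →ₗ[ℝ] (m → ℝ))

/-- The matrix `E₁ = E - F Q`. -/
def pencilE1 {n : Type*} [Fintype n] (E F Q : Matrix n n ℝ) : Matrix n n ℝ :=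
  E - F * Q

/-- The matrix `E₂ = E₁ - F (I - Q) Q₁`. -/
def pencilE2 {n : Type*} [Fintype n] [DecidableEq n] (E F Q Q₁ : Matrix n n ℝ) :
    Matrix n n ℝ :=
  pencilE1 E F Q - F * (1 - Q) * Q₁

/-- The matrix pencil `λ E - F` has tractability index two: for any projector `Q` onto `ker E`,
the matrix `E₁` is singular and, for any projector `Q₁` onto `ker E₁`, the matrix `E₂` is
nonsingular. -/
def PencilHasTractabilityIndexTwo {n : Type*} [Fintype n] [DecidableEq n]
    (E F : Matrix n n ℝ) : Prop :=
  ∀ Q : Matrix n n ℝ, IsProjectorOnto Q (matrixKer E) →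
    ¬ IsUnit (pencilE1 E F Q) ∧
    ∀ Q₁ : Matrix n n ℝ, IsProjectorOnto Q₁ (matrixKer (pencilE1 E F Q)) →
      IsUnit (pencilE2 E F Q Q₁)

/-- The semilinear differential-algebraic equation `E z' = f (z, t)`, with `f` of class `C¹` in
`z`, has tractability index two on the set `Ω` of values of `z`: with `F = f_z`, the pencil
`λ E - F (z, t)` has tractability index two for all `z ∈ Ω` and all `t`, and the kernel of
`E₁ (z, t)` admits a continuous projector `Q₁ (z, t)`. -/
def HasTractabilityIndexTwo {n : Type*} [Fintype n] [DecidableEq n]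
    (E : Matrix n n ℝ) (f : (n → ℝ) → ℝ → (n → ℝ)) (Ω : Set (n → ℝ)) : Prop :=
  (∀ t : ℝ, ContDiff ℝ 1 (fun z => f z t)) ∧
  (∀ z ∈ Ω, ∀ t : ℝ, PencilHasTractabilityIndexTwo E (jacobian (fun y => f y t) z)) ∧
  (∀ Q : Matrix n n ℝ, IsProjectorOnto Q (matrixKer E) →
    ∃ Q₁ : (n → ℝ) → ℝ → Matrix n n ℝ,
      ContinuousOn (fun p : (n → ℝ) × ℝ => Q₁ p.1 p.2) (Ω ×ˢ Set.univ) ∧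
      ∀ z ∈ Ω, ∀ t : ℝ,
        IsProjectorOnto (Q₁ z t)
          (matrixKer (pencilE1 E (jacobian (fun y => f y t) z) Q)))

/-! ### Circuits -/

/-- The types of devices: capacitors `c`, inductors `l`, current-controlled resistors `r`,
voltage-controlled resistors `g`, `q`-memristors `m`, `φ`-memristors `w`, voltage-controlled
memcapacitors `mc`, current-controlled meminductors `ml`, current-controlled hybrid memristors
`hm`, voltage-controlled hybrid memristors `hw`, voltage sources `u`, current sources `j`. -/
inductive DeviceKind
  | c | l | r | g | m | w | mc | ml | hm | hw | u | j
  deriving DecidableEq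

/-- The underlying directed multigraph of a circuit with set of nodes `N` and, for each type `k`
of devices, set of branches `B k`, together with the choice of a reference node. -/
structure CircuitGraph (N : Type*) (B : DeviceKind → Type*) where
  /-- the reference node -/
  ref : N
  /-- the node that a branch leaves -/
  src : (k : DeviceKind) → B k → N
  /-- the node that a branch enters -/
  tgt : (k : DeviceKind) → B k → N

namespace CircuitGraph

variable {N : Type*} {B : DeviceKind → Type*}

/-- The branches of the circuit, of all types. -/
abbrev Branch (_G : CircuitGraph N B) : Type _ := Σ k : DeviceKind, B k

/-- The nodes other than the reference node. -/
abbrev NonRef (G : CircuitGraph N B) : Type _ := {n : N // n ≠ G.ref}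

/-- The columns of the reduced incidence matrix that correspond to the devices of type `k`:
`1` if the branch leaves the node, `-1` if it enters the node, `0` if it is not incident
with the node. -/
def A [DecidableEq N] (G : CircuitGraph N B) (k : DeviceKind) : Matrix G.NonRef (B k) ℝ :=
  Matrix.of fun n b =>
    (if G.src k b = n.1 then 1 else 0) - (if G.tgt k b = n.1 then 1 else 0)

/-- The branch `b` joins the nodes `x` and `y`, in either direction. -/
def Joins (G : CircuitGraph N B) (b : G.Branch) (x y : N) : Prop :=
  (G.src b.1 b.2 = x ∧ G.tgt b.1 b.2 = y) ∨ (G.src b.1 b.2 = y ∧ G.tgt b.1 b.2 = x)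

/-- After the deletion of the branches in `K`, all nodes belong to one connected component. -/
def ConnectedWithout (G : CircuitGraph N B) (K : Set G.Branch) : Prop :=
  ∀ x y : N, Relation.EqvGen (fun p q => ∃ b : G.Branch, b ∉ K ∧ G.Joins b p q) x y

/-- The circuit is connected. -/
def Connected (G : CircuitGraph N B) : Prop := G.ConnectedWithout ∅

/-- `S` is the set of branches of a loop: a cyclic arrangement of at least one pairwise distinct
nodes and as many pairwise distinct branches, each of which joins a node to the next one
(addition in `Fin (n + 1)` is cyclic). -/
def IsLoop (G : CircuitGraph N B) (S : Set G.Branch) : Prop :=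
  ∃ (n : ℕ) (v : Fin (n + 1) → N) (b : Fin (n + 1) → G.Branch),
    Function.Injective v ∧ Function.Injective b ∧
    (∀ k, G.Joins (b k) (v k) (v (k + 1))) ∧ Set.range b = S

/-- `K` is a cutset of a connected circuit: the deletion of `K` disconnects the circuit, and `K`
is minimal with respect to this property. -/
def IsCutset (G : CircuitGraph N B) (K : Set G.Branch) : Prop :=
  ¬ G.ConnectedWithout K ∧ ∀ K' : Set G.Branch, K' ⊂ K → G.ConnectedWithout K'

/-- There is a loop all of whose branches have their type in `T`. -/
def HasLoopOf (G : CircuitGraph N B) (T : Set DeviceKind) : Prop :=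
  ∃ S : Set G.Branch, G.IsLoop S ∧ ∀ b ∈ S, b.1 ∈ T

/-- There is a cutset all of whose branches have their type in `T`. -/
def HasCutsetOf (G : CircuitGraph N B) (T : Set DeviceKind) : Prop :=
  ∃ K : Set G.Branch, G.IsCutset K ∧ ∀ b ∈ K, b.1 ∈ T

/-- The circuit has a loop defined by voltage sources, capacitors and/or memcapacitors, or a
cutset composed of current sources, inductors and/or meminductors. -/
def TopologicallyDegenerate (G : CircuitGraph N B) : Prop :=
  G.HasLoopOf {DeviceKind.u, DeviceKind.c, DeviceKind.mc} ∨
  G.HasCutsetOf {DeviceKind.j, DeviceKind.l, DeviceKind.ml}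

end CircuitGraph

/-- The time-invariant `C¹` characteristics of the devices, with full coupling allowed within each
type, and the excitations of the sources. -/
structure Characteristics (B : DeviceKind → Type*) [∀ k, Fintype (B k)] where
  /-- capacitors, `q = γ_c (v)` -/
  γc : (B .c → ℝ) → (B .c → ℝ)
  /-- inductors, `φ = γ_l (i)` -/
  γl : (B .l → ℝ) → (B .l → ℝ)
  /-- current-controlled resistors, `v = γ_r (i)` -/
  γr : (B .r → ℝ) → (B .r → ℝ)
  /-- voltage-controlled resistors, `i = γ_g (v)` -/
  γg : (B .g → ℝ) → (B .g → ℝ)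
  /-- `q`-memristors, `v = η (q, i)` -/
  η : (B .m → ℝ) → (B .m → ℝ) → (B .m → ℝ)
  /-- `φ`-memristors, `i = ζ (φ, v)` -/
  ζ : (B .w → ℝ) → (B .w → ℝ) → (B .w → ℝ)
  /-- memcapacitors, `q = ω (φ, v)` -/
  ω : (B .mc → ℝ) → (B .mc → ℝ) → (B .mc → ℝ)
  /-- meminductors, `φ = θ (q, i)` -/
  θ : (B .ml → ℝ) → (B .ml → ℝ) → (B .ml → ℝ)
  /-- current-controlled hybrid memristors, `v = ψ (q, φ, i)` -/
  ψ : (B .hm → ℝ) → (B .hm → ℝ) → (B .hm → ℝ) → (B .hm → ℝ)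
  /-- voltage-controlled hybrid memristors, `i = ξ (q, φ, v)` -/
  ξ : (B .hw → ℝ) → (B .hw → ℝ) → (B .hw → ℝ) → (B .hw → ℝ)
  /-- voltages of the voltage sources -/
  vs : ℝ → (B .u → ℝ)
  /-- currents of the current sources -/
  is : ℝ → (B .j → ℝ)
  γc_C1 : ContDiff ℝ 1 γc
  γl_C1 : ContDiff ℝ 1 γl
  γr_C1 : ContDiff ℝ 1 γr
  γg_C1 : ContDiff ℝ 1 γg
  η_C1 : ContDiff ℝ 1 (fun p : (B .m → ℝ) × (B .m → ℝ) => η p.1 p.2)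
  ζ_C1 : ContDiff ℝ 1 (fun p : (B .w → ℝ) × (B .w → ℝ) => ζ p.1 p.2)
  ω_C1 : ContDiff ℝ 1 (fun p : (B .mc → ℝ) × (B .mc → ℝ) => ω p.1 p.2)
  θ_C1 : ContDiff ℝ 1 (fun p : (B .ml → ℝ) × (B .ml → ℝ) => θ p.1 p.2)
  ψ_C1 : ContDiff ℝ 1
    (fun p : (B .hm → ℝ) × (B .hm → ℝ) × (B .hm → ℝ) => ψ p.1 p.2.1 p.2.2)
  ξ_C1 : ContDiff ℝ 1
    (fun p : (B .hw → ℝ) × (B .hw → ℝ) × (B .hw → ℝ) => ξ p.1 p.2.1 p.2.2)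

/-! ### The nodal model -/

/-- The groups of dynamic variables of the nodal model. -/
inductive DynKind
  | qc | qmc | φl | φml | qm | qml | qhm | qhw | φw | φmc | φhm | φhw
  deriving DecidableEq

instance : Fintype DynKind where
  elems := {.qc, .qmc, .φl, .φml, .qm, .qml, .qhm, .qhw, .φw, .φmc, .φhm, .φhw}
  complete := by intro x; cases x <;> decide

/-- The type of devices to which a group of dynamic variables belongs. -/
abbrev DynKind.device : DynKind → DeviceKind
  | qc => .c
  | qmc => .mc
  | φl => .l
  | φml => .ml
  | qm => .m
  | qml => .ml
  | qhm => .hm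
  | qhw => .hw
  | φw => .w
  | φmc => .mc
  | φhm => .hm
  | φhw => .hw

/-- The groups of branch currents among the algebraic variables of the nodal model. -/
inductive CurKind
  | ic | imc | iu | il | iml | ir | im | ihm | ihw
  deriving DecidableEq

instance : Fintype CurKind where
  elems := {.ic, .imc, .iu, .il, .iml, .ir, .im, .ihm, .ihw}
  complete := by intro x; cases x <;> decide

/-- The type of devices to which a group of branch currents belongs. -/
abbrev CurKind.device : CurKind → DeviceKind
  | ic => .c
  | imc => .mc
  | iu => .u
  | il => .l
  | iml => .ml
  | ir => .r
  | im => .m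
  | ihm => .hm
  | ihw => .hw

namespace CircuitGraph

variable {N : Type*} {B : DeviceKind → Type*}

/-- Index type of the dynamic variables. -/
abbrev DynIdx (_G : CircuitGraph N B) : Type _ := Σ d : DynKind, B d.device

/-- Index type of the algebraic variables: node potentials and branch currents. -/
abbrev AlgIdx (G : CircuitGraph N B) : Type _ := G.NonRef ⊕ (Σ a : CurKind, B a.device)

/-- Index type of all variables of the nodal model, and also of its equations. -/
abbrev Idx (G : CircuitGraph N B) : Type _ := G.DynIdx ⊕ G.AlgIdx

/-- A group of dynamic variables in the vector `z` of all variables. -/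
def dyn (G : CircuitGraph N B) (z : G.Idx → ℝ) (d : DynKind) : B d.device → ℝ :=
  fun b => z (Sum.inl ⟨d, b⟩)

/-- The node potentials `e` in the vector `z` of all variables. -/
def pot (G : CircuitGraph N B) (z : G.Idx → ℝ) : G.NonRef → ℝ :=
  fun n => z (Sum.inr (Sum.inl n))

/-- A group of branch currents in the vector `z` of all variables. -/
def cur (G : CircuitGraph N B) (z : G.Idx → ℝ) (a : CurKind) : B a.device → ℝ :=
  fun b => z (Sum.inr (Sum.inr ⟨a, b⟩))

variable [Fintype N] [DecidableEq N] [∀ k, Fintype (B k)] [∀ k, DecidableEq (B k)]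

/-- The branch voltages `A_kᵀ e` of the devices of type `k`. -/
def volt (G : CircuitGraph N B) (z : G.Idx → ℝ) (k : DeviceKind) : B k → ℝ :=
  (G.A k).transpose.mulVec (G.pot z)

/-- The left-hand side matrix `E = block-diag(I, 0)` of the nodal model `E z' = f (z, t)`. -/
def nodalE (G : CircuitGraph N B) : Matrix G.Idx G.Idx ℝ :=
  Matrix.fromBlocks 1 0 0 0

/-- The right-hand side `f (z, t)` of the nodal model `E z' = f (z, t)`. -/
def nodalRHS (G : CircuitGraph N B) (D : Characteristics B) (z : G.Idx → ℝ) (t : ℝ) :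
    G.Idx → ℝ
  -- differential equations
  | .inl ⟨.qc, b⟩ => G.cur z .ic b
  | .inl ⟨.qmc, b⟩ => G.cur z .imc b
  | .inl ⟨.φl, b⟩ => G.volt z .l b
  | .inl ⟨.φml, b⟩ => G.volt z .ml b
  | .inl ⟨.qm, b⟩ => G.cur z .im b
  | .inl ⟨.qml, b⟩ => G.cur z .iml b
  | .inl ⟨.qhm, b⟩ => G.cur z .ihm b
  | .inl ⟨.qhw, b⟩ => G.cur z .ihw b
  | .inl ⟨.φw, b⟩ => G.volt z .w b
  | .inl ⟨.φmc, b⟩ => G.volt z .mc b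
  | .inl ⟨.φhm, b⟩ => G.volt z .hm b
  | .inl ⟨.φhw, b⟩ => G.volt z .hw b
  -- Kirchhoff current law at the non-reference nodes
  | .inr (.inl n) =>
      ((G.A .c).mulVec (G.cur z .ic) + (G.A .mc).mulVec (G.cur z .imc)
        + (G.A .u).mulVec (G.cur z .iu) + (G.A .l).mulVec (G.cur z .il)
        + (G.A .ml).mulVec (G.cur z .iml)
        + (G.A .g).mulVec (D.γg (G.volt z .g))
        + (G.A .w).mulVec (D.ζ (G.dyn z .φw) (G.volt z .w))
        + (G.A .r).mulVec (G.cur z .ir) + (G.A .m).mulVec (G.cur z .im)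
        + (G.A .hm).mulVec (G.cur z .ihm) + (G.A .hw).mulVec (G.cur z .ihw)
        + (G.A .j).mulVec (D.is t)) n
  -- characteristics of the devices
  | .inr (.inr ⟨.ic, b⟩) => G.dyn z .qc b - D.γc (G.volt z .c) b
  | .inr (.inr ⟨.imc, b⟩) => G.dyn z .qmc b - D.ω (G.dyn z .φmc) (G.volt z .mc) b
  | .inr (.inr ⟨.iu, b⟩) => D.vs t b - G.volt z .u b
  | .inr (.inr ⟨.il, b⟩) => G.dyn z .φl b - D.γl (G.cur z .il) b
  | .inr (.inr ⟨.iml, b⟩) => G.dyn z .φml b - D.θ (G.dyn z .qml) (G.cur z .iml) b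
  | .inr (.inr ⟨.ir, b⟩) => D.γr (G.cur z .ir) b - G.volt z .r b
  | .inr (.inr ⟨.im, b⟩) => D.η (G.dyn z .qm) (G.cur z .im) b - G.volt z .m b
  | .inr (.inr ⟨.ihm, b⟩) =>
      D.ψ (G.dyn z .qhm) (G.dyn z .φhm) (G.cur z .ihm) b - G.volt z .hm b
  | .inr (.inr ⟨.ihw, b⟩) =>
      G.cur z .ihw b - D.ξ (G.dyn z .qhw) (G.dyn z .φhw) (G.volt z .hw) b

/-! The incremental matrices of the devices at the state `z`. -/

/-- Incremental capacitance `C`. -/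
noncomputable def capacitance (G : CircuitGraph N B) (D : Characteristics B) (z : G.Idx → ℝ) :
    Matrix (B .c) (B .c) ℝ :=
  jacobian D.γc (G.volt z .c)

/-- Incremental memcapacitance `C_m`. -/
noncomputable def memcapacitance (G : CircuitGraph N B) (D : Characteristics B)
    (z : G.Idx → ℝ) : Matrix (B .mc) (B .mc) ℝ :=
  jacobian (fun v => D.ω (G.dyn z .φmc) v) (G.volt z .mc)

/-- Incremental inductance `L`. -/
noncomputable def inductance (G : CircuitGraph N B) (D : Characteristics B) (z : G.Idx → ℝ) :
    Matrix (B .l) (B .l) ℝ :=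
  jacobian D.γl (G.cur z .il)

/-- Incremental meminductance `L_m`. -/
noncomputable def meminductance (G : CircuitGraph N B) (D : Characteristics B)
    (z : G.Idx → ℝ) : Matrix (B .ml) (B .ml) ℝ :=
  jacobian (fun i => D.θ (G.dyn z .qml) i) (G.cur z .iml)

/-- Incremental resistance `R`. -/
noncomputable def resistance (G : CircuitGraph N B) (D : Characteristics B) (z : G.Idx → ℝ) :
    Matrix (B .r) (B .r) ℝ :=
  jacobian D.γr (G.cur z .ir)

/-- Incremental conductance `G`. -/
noncomputable def conductance (G : CircuitGraph N B) (D : Characteristics B) (z : G.Idx → ℝ) :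
    Matrix (B .g) (B .g) ℝ :=
  jacobian D.γg (G.volt z .g)

/-- Incremental memristance `M`. -/
noncomputable def memristance (G : CircuitGraph N B) (D : Characteristics B) (z : G.Idx → ℝ) :
    Matrix (B .m) (B .m) ℝ :=
  jacobian (fun i => D.η (G.dyn z .qm) i) (G.cur z .im)

/-- Incremental memductance `W`. -/
noncomputable def memductance (G : CircuitGraph N B) (D : Characteristics B) (z : G.Idx → ℝ) :
    Matrix (B .w) (B .w) ℝ :=
  jacobian (fun v => D.ζ (G.dyn z .φw) v) (G.volt z .w)

/-- Incremental hybrid memristance `M_h`. -/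
noncomputable def hybridMemristance (G : CircuitGraph N B) (D : Characteristics B)
    (z : G.Idx → ℝ) : Matrix (B .hm) (B .hm) ℝ :=
  jacobian (fun i => D.ψ (G.dyn z .qhm) (G.dyn z .φhm) i) (G.cur z .ihm)

/-- Incremental hybrid memductance `W_h`. -/
noncomputable def hybridMemductance (G : CircuitGraph N B) (D : Characteristics B)
    (z : G.Idx → ℝ) : Matrix (B .hw) (B .hw) ℝ :=
  jacobian (fun v => D.ξ (G.dyn z .qhw) (G.dyn z .φhw) v) (G.volt z .hw)

end CircuitGraph

/-!
Since `E = block-diag(I, 0)` is idempotent, the projectors can be eliminated: in block form, `E₁` is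
singular if and only if `F₂₂` is, and `E₂` is nonsingular provided that `w = 0` is the only
`w ∈ ker F₂₂` with `F₂₁ F₁₂ w ∈ im F₂₂` (`pencilHasTractabilityIndexTwo_of_idempotent`).

The linear map `F = f_z` is the right-hand side of the nodal model of the linearised circuit
(`CircuitGraph.jacobian_nodalRHS_mulVec`), and positive definiteness of the incremental matrices
makes this circuit strictly passive. Tellegen's theorem then identifies `ker F₂₂`
(`Characteristics.IsPassive.isDegenerateMode`): its elements are the degenerate modes, that is,
currents circulating in branches of types `u`, `c`, `mc`, together with potentials for which only
the branches of types `j`, `l`, `ml` have a voltage.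

* Topological degeneracy is the existence of a nonzero degenerate mode: a loop carries a unit
  current, and a cutset supports a step of the potential.
* If `F₂₁ F₁₂ w ∈ im F₂₂`, two more power balances show that the mode `w` has neither capacitive
  currents nor inductive voltages (`CircuitGraph.IsDegenerateMode.eq_zero_of_velocity`). What is
  left of it is a circulation in voltage sources and a potential supported by current sources, and
  both vanish in a well-posed circuit. This uses the converse graph theory: a nonzero circulation
  contains a loop, a nonzero potential gives a cutset.
* Neither the degenerate modes nor the differential equations involve the characteristics, so
  `ker E₁` is constant on `Ω × ℝ` and a constant projector `Q₁` is available.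
-/

/-! ### Pencils with an idempotent leading matrix -/

section Pencil

variable {n : Type*} [Fintype n]

lemma mem_matrixKer {M : Matrix n n ℝ} {v : n → ℝ} : v ∈ matrixKer M ↔ M.mulVec v = 0 := by
  simp [matrixKer]

namespace IsProjectorOnto

variable {P : Matrix n n ℝ} {S : Submodule ℝ (n → ℝ)}

lemma mulVec_mem (h : IsProjectorOnto P S) (v : n → ℝ) : P.mulVec v ∈ S := by
  rw [← h.2]
  exact ⟨v, rfl⟩

lemma mulVec_eq_self (h : IsProjectorOnto P S) {v : n → ℝ} (hv : v ∈ S) : P.mulVec v = v := by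
  rw [← h.2] at hv
  obtain ⟨u, rfl⟩ := hv
  simp [Matrix.mulVec_mulVec, h.1]

end IsProjectorOnto

lemma mem_matrixKer_pencilE1 {E F Q : Matrix n n ℝ} {u : n → ℝ} :
    u ∈ matrixKer (pencilE1 E F Q) ↔ E.mulVec u = F.mulVec (Q.mulVec u) := by
  rw [mem_matrixKer, pencilE1, Matrix.sub_mulVec, sub_eq_zero, Matrix.mulVec_mulVec]

/-- `ker E₁` depends on `F` only through the restriction of `F` to `{w ∈ ker E | F w ∈ im E}`. -/
lemma matrixKer_pencilE1_le {E F F' Q : Matrix n n ℝ} (hE : E * E = E)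
    (hQ : IsProjectorOnto Q (matrixKer E))
    (h : ∀ w, E.mulVec w = 0 → E.mulVec (F.mulVec w) = F.mulVec w →
      F'.mulVec w = F.mulVec w) :
    matrixKer (pencilE1 E F Q) ≤ matrixKer (pencilE1 E F' Q) := by
  intro u hu
  rw [mem_matrixKer_pencilE1] at hu ⊢
  rw [h _ (mem_matrixKer.1 (hQ.mulVec_mem u)) (by rw [← hu, Matrix.mulVec_mulVec, hE]), hu]

variable [DecidableEq n]

lemma exists_isProjectorOnto (S : Submodule ℝ (n → ℝ)) :
    ∃ P : Matrix n n ℝ, IsProjectorOnto P S := by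
  obtain ⟨T, hT⟩ := S.exists_isCompl
  have hr : LinearMap.range (S.projection T hT) = S := Submodule.range_projection hT
  refine ⟨LinearMap.toMatrix' (S.projection T hT), ?_, ?_⟩
  · rw [← LinearMap.toMatrix'_mul]
    congr 1
    exact Submodule.isIdempotentElem_projection hT
  · rw [← Matrix.toLin'_apply', Matrix.toLin'_toMatrix', hr]

lemma isUnit_iff_forall_mulVec_eq_zero {M : Matrix n n ℝ} :
    IsUnit M ↔ ∀ v, M.mulVec v = 0 → v = 0 := by
  rw [← Matrix.mulVec_injective_iff_isUnit]
  exact injective_iff_map_eq_zero M.mulVecLin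

/-- Index two for an idempotent `E`, without reference to projectors. In the block form
`E = block-diag(I, 0)` the two hypotheses say that `F₂₂` is singular and that the only
`w ∈ ker F₂₂` with `F₂₁ F₁₂ w ∈ im F₂₂` is `w = 0`. -/
lemma pencilHasTractabilityIndexTwo_of_idempotent {E F : Matrix n n ℝ} (hE : E * E = E)
    (hsing : ∃ w, w ≠ 0 ∧ E.mulVec w = 0 ∧ E.mulVec (F.mulVec w) = F.mulVec w)
    (hreg : ∀ w y, E.mulVec w = 0 → E.mulVec y = 0 → E.mulVec (F.mulVec w) = F.mulVec w →
      E.mulVec (F.mulVec (F.mulVec w + y)) = F.mulVec (F.mulVec w + y) → w = 0) :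
    PencilHasTractabilityIndexTwo E F := by
  intro Q hQ
  have hEE : ∀ v, E.mulVec (E.mulVec v) = E.mulVec v := fun v => by
    rw [Matrix.mulVec_mulVec, hE]
  have hEQ : ∀ v, E.mulVec (Q.mulVec v) = 0 := fun v => mem_matrixKer.1 (hQ.mulVec_mem v)
  have hQE : ∀ v, E.mulVec v = 0 → Q.mulVec v = v := fun v hv =>
    hQ.mulVec_eq_self (mem_matrixKer.2 hv)
  refine ⟨fun hunit => ?_, fun Q₁ hQ₁ => ?_⟩
  · obtain ⟨w, hw0, hEw, hFw⟩ := hsing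
    -- `u = w + (I - Q) F w` satisfies `Q u = w` and `E u = F w`
    have hQu : Q.mulVec (w + (F.mulVec w - Q.mulVec (F.mulVec w))) = w := by
      rw [Matrix.mulVec_add, Matrix.mulVec_sub, hQE w hEw, hQE _ (hEQ _), sub_self, add_zero]
    have hu : w + (F.mulVec w - Q.mulVec (F.mulVec w)) ∈ matrixKer (pencilE1 E F Q) := by
      rw [mem_matrixKer_pencilE1, hQu, Matrix.mulVec_add, Matrix.mulVec_sub, hEw, hEQ, hFw]
      simp
    have := isUnit_iff_forall_mulVec_eq_zero.1 hunit _ (mem_matrixKer.1 hu)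
    rw [this, Matrix.mulVec_zero] at hQu
    exact hw0 hQu.symm
  · rw [isUnit_iff_forall_mulVec_eq_zero]
    intro v hv
    have hu := mem_matrixKer_pencilE1.1 (hQ₁.mulVec_mem v)
    set u := Q₁.mulVec v with hudef
    set w := Q.mulVec u with hwdef
    have hv' : E.mulVec v - F.mulVec (Q.mulVec v) = F.mulVec u - F.mulVec w := by
      rw [pencilE2, pencilE1, Matrix.sub_mulVec, sub_eq_zero] at hv
      simpa [Matrix.sub_mulVec, ← Matrix.mulVec_mulVec, Matrix.mulVec_sub] using hv
    -- `E u = F w`, so `u` splits as `F w + (u - E u)`, and `F` maps `F w + y` to `E v`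
    have hy : F.mulVec (F.mulVec w + (u - E.mulVec u + Q.mulVec v - w)) = E.mulVec v := by
      rw [← hu]
      have : E.mulVec u + (u - E.mulVec u + Q.mulVec v - w) = u - w + Q.mulVec v := by abel
      rw [this, Matrix.mulVec_add, Matrix.mulVec_sub, ← hv']
      abel
    have hw : w = 0 := by
      refine hreg w (u - E.mulVec u + Q.mulVec v - w) (hEQ u) ?_ ?_ ?_
      · rw [Matrix.mulVec_sub, Matrix.mulVec_add, Matrix.mulVec_sub, hEE, hEQ, hEQ]
        simp
      · rw [← hu, hEE]
      · rw [hy, hEE]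
    have hu0 : u = 0 := by
      rw [hw, Matrix.mulVec_zero] at hu
      rw [← hQE u hu]
      exact hw
    rw [hu0, hw, sub_self, sub_eq_zero] at hv'
    rw [← hu0, hudef]
    exact (hQ₁.mulVec_eq_self (mem_matrixKer_pencilE1.2 hv')).symm

end Pencil

/-! ### Loops, cutsets and the incidence matrix -/

instance : Fintype DeviceKind where
  elems := {.c, .l, .r, .g, .m, .w, .mc, .ml, .hm, .hw, .u, .j}
  complete := by intro x; cases x <;> decide

namespace CircuitGraph

variable {N : Type*} {B : DeviceKind → Type*}

/-- A nonbacktracking closed walk of minimal length is a loop. -/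
lemma hasLoopOf_of_nonbacktracking [Finite N] (G : CircuitGraph N B) {T : Set DeviceKind}
    (v : ℕ → N) (b : ℕ → G.Branch) (hT : ∀ i, (b i).1 ∈ T)
    (hj : ∀ i, G.Joins (b i) (v i) (v (i + 1))) (hb : ∀ i, b (i + 1) ≠ b i) :
    G.HasLoopOf T := by
  classical
  have hex : ∃ d, ∃ i, v i = v (i + d + 1) := by
    obtain ⟨i, j, hij, h⟩ := Finite.exists_ne_map_eq_of_infinite v
    rcases lt_or_gt_of_ne hij with hlt | hlt
    · exact ⟨j - i - 1, i, by rw [h]; congr 1; omega⟩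
    · exact ⟨i - j - 1, j, by rw [← h]; congr 1; omega⟩
  obtain ⟨i, hi⟩ := Nat.find_spec hex
  set d := Nat.find hex with hd
  have hmin : ∀ p q, p < q → q < p + d + 1 → v p ≠ v q := fun p q hpq hq h =>
    Nat.find_min hex (m := q - p - 1) (by omega) ⟨p, by rw [h]; congr 1; omega⟩
  have hbinj : ∀ p q, p < q → i ≤ p → q ≤ i + d → b p ≠ b q := by
    intro p q hpq hip hqd h
    have h1 := hj p
    have h2 := hj q
    rw [← h] at h2
    have key : v p = v q ∨ v (p + 1) = v q := by
      rcases h1 with ⟨a1, a2⟩ | ⟨a1, a2⟩ <;> rcases h2 with ⟨c1, c2⟩ | ⟨c1, c2⟩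
      · exact .inl (a1.symm.trans c1)
      · exact .inr (a2.symm.trans c2)
      · exact .inr (a1.symm.trans c1)
      · exact .inl (a2.symm.trans c2)
    rcases key with h3 | h3
    · exact hmin p q hpq (by omega) h3
    · rcases Nat.lt_or_ge (p + 1) q with hlt | hge
      · exact hmin (p + 1) q hlt (by omega) h3
      · obtain rfl : q = p + 1 := by omega
        exact hb p h.symm
  refine ⟨Set.range fun k : Fin (d + 1) => b (i + k),
    ⟨d, fun k => v (i + k), fun k => b (i + k), ?_, ?_, ?_, rfl⟩, ?_⟩
  · intro p q h
    by_contra hpq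
    rcases lt_or_gt_of_ne (fun h => hpq (Fin.ext h) : (p : ℕ) ≠ q) with hlt | hlt
    · exact hmin _ _ (by omega) (by omega) h
    · exact hmin _ _ (by omega) (by omega) h.symm
  · intro p q h
    by_contra hpq
    rcases lt_or_gt_of_ne (fun h => hpq (Fin.ext h) : (p : ℕ) ≠ q) with hlt | hlt
    · exact hbinj _ _ (by omega) (by omega) (by omega) h
    · exact hbinj _ _ (by omega) (by omega) (by omega) h.symm
  · intro k
    have := hj (i + k)
    by_cases hk : k = Fin.last d
    · subst hk
      rw [Fin.last_add_one]
      simpa [hi] using this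
    · dsimp only
      rw [Fin.val_add_one_of_lt (Fin.lt_last_iff_ne_last.2 hk)]
      exact this
  · rintro _ ⟨k, rfl⟩
    exact hT _

variable [DecidableEq N]

/-- Node potentials, extended by zero to the reference node. -/
def extendPot (G : CircuitGraph N B) (e : G.NonRef → ℝ) (n : N) : ℝ :=
  if h : n ≠ G.ref then e ⟨n, h⟩ else 0

lemma transpose_mulVec_apply [Fintype N] (G : CircuitGraph N B) (e : G.NonRef → ℝ) (k : DeviceKind)
    (b : B k) :
    (G.A k).transpose.mulVec e b = G.extendPot e (G.src k b) - G.extendPot e (G.tgt k b) := by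
  have aux : ∀ m : N, ∑ n : G.NonRef, (if m = n.1 then 1 else 0) * e n = G.extendPot e m := by
    intro m
    by_cases hm : m = G.ref
    · rw [extendPot, dif_neg (by simpa using hm)]
      refine Finset.sum_eq_zero fun n _ => ?_
      rw [if_neg (fun h => n.2 (h.symm.trans hm)), zero_mul]
    · rw [extendPot, dif_pos hm, Finset.sum_eq_single ⟨m, hm⟩]
      · simp
      · intro n _ hn
        rw [if_neg (fun h => hn (Subtype.ext h.symm)), zero_mul]
      · simp
  simp only [Matrix.mulVec, dotProduct, Matrix.transpose_apply, A, Matrix.of_apply, sub_mul,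
    Finset.sum_sub_distrib, aux]

/-- The potentials that equal one on the nodes which a cutset separates from the reference node
and zero elsewhere. -/
lemma HasCutsetOf.exists_pot [Fintype N] {G : CircuitGraph N B} {T : Set DeviceKind}
    (h : G.HasCutsetOf T) :
    ∃ e : G.NonRef → ℝ, e ≠ 0 ∧ ∀ k, k ∉ T → (G.A k).transpose.mulVec e = 0 := by
  classical
  obtain ⟨K, ⟨hK, -⟩, hT⟩ := h
  let R := Relation.EqvGen (fun p q => ∃ b : G.Branch, b ∉ K ∧ G.Joins b p q)
  let e : G.NonRef → ℝ := fun n => if R n.1 G.ref then 0 else 1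
  have hext : ∀ n, G.extendPot e n = if R n G.ref then 0 else 1 := by
    intro n
    by_cases hn : n = G.ref
    · subst hn
      rw [extendPot, dif_neg (by simp), if_pos (Relation.EqvGen.refl _)]
    · rw [extendPot, dif_pos hn]
  refine ⟨e, fun h0 => hK fun x y => ?_, fun k hk => funext fun b => ?_⟩
  · have hall : ∀ n, R n G.ref := by
      intro n
      by_cases hn : n = G.ref
      · subst hn
        exact Relation.EqvGen.refl _
      · by_contra hR
        have := congrFun h0 ⟨n, hn⟩
        simp [e, hR] at this
    exact (hall x).trans _ _ _ ((hall y).symm _ _)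
  · rw [transpose_mulVec_apply, hext, hext]
    have hR : R (G.src k b) (G.tgt k b) :=
      Relation.EqvGen.rel _ _ ⟨⟨k, b⟩, fun hb => hk (hT _ hb), Or.inl ⟨rfl, rfl⟩⟩
    have hiff : R (G.src k b) G.ref ↔ R (G.tgt k b) G.ref :=
      ⟨fun h => (hR.symm _ _).trans _ _ _ h, fun h => hR.trans _ _ _ h⟩
    simp [hiff]

variable [∀ k, Fintype (B k)]

/-- The entry of the full (not reduced) incidence matrix at a node and a branch. -/
def incidence (G : CircuitGraph N B) (n : N) (b : G.Branch) : ℝ :=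
  (if G.src b.1 b.2 = n then 1 else 0) - (if G.tgt b.1 b.2 = n then 1 else 0)

/-- The currents `x` satisfy the Kirchhoff current law at every node, the reference node
included. -/
def IsCirculation (G : CircuitGraph N B) (x : G.Branch → ℝ) : Prop :=
  ∀ n : N, ∑ b, G.incidence n b * x b = 0

lemma sum_mulVec_apply (G : CircuitGraph N B) (x : G.Branch → ℝ) (n : G.NonRef) :
    (∑ k, (G.A k).mulVec (fun b => x ⟨k, b⟩)) n = ∑ b, G.incidence n.1 b * x b := by
  rw [Fintype.sum_sigma, Finset.sum_apply]
  rfl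

/-- Since every column of the full incidence matrix sums to zero, the current law at the reference
node follows from the others. -/
lemma isCirculation_iff [Fintype N] (G : CircuitGraph N B) (x : G.Branch → ℝ) :
    G.IsCirculation x ↔ ∑ k, (G.A k).mulVec (fun b => x ⟨k, b⟩) = 0 := by
  constructor
  · intro h
    funext n
    rw [sum_mulVec_apply]
    exact h n
  · intro h
    have hne : ∀ n, n ≠ G.ref → ∑ b, G.incidence n b * x b = 0 := fun n hn => by
      rw [← G.sum_mulVec_apply x ⟨n, hn⟩, h]
      rfl
    have htot : ∑ n, ∑ b, G.incidence n b * x b = 0 := by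
      rw [Finset.sum_comm]
      refine Finset.sum_eq_zero fun b _ => ?_
      rw [← Finset.sum_mul]
      simp [incidence]
    intro n
    by_cases hn : n = G.ref
    · subst hn
      rwa [Finset.sum_eq_single G.ref (fun n _ hn => hne n hn) (by simp)] at htot
    · exact hne n hn

/-- The branches that carry a nonzero circulation contain a loop: unless one of them is a
self-loop, no node meets exactly one of them, so that a nonbacktracking walk along them never
stops. -/
lemma IsCirculation.hasLoopOf [Finite N] {G : CircuitGraph N B} {T : Set DeviceKind}
    {x : G.Branch → ℝ}
    (hx : G.IsCirculation x) (hT : ∀ b, x b ≠ 0 → b.1 ∈ T) (hne : x ≠ 0) : G.HasLoopOf T := by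
  classical
  by_cases hself : ∃ b : G.Branch, x b ≠ 0 ∧ G.src b.1 b.2 = G.tgt b.1 b.2
  · obtain ⟨b, hb, hst⟩ := hself
    refine ⟨{b}, ⟨0, fun _ => G.src b.1 b.2, fun _ => b, fun _ _ _ => Fin.ext (by omega),
      fun _ _ _ => Fin.ext (by omega), fun _ => Or.inl ⟨rfl, hst.symm⟩, by simp⟩, ?_⟩
    rintro _ rfl
    exact hT _ hb
  · push Not at hself
    let State := {s : N × G.Branch × N // x s.2.1 ≠ 0 ∧ G.Joins s.2.1 s.1 s.2.2}
    have step : ∀ s : State, ∃ s' : State, s'.1.1 = s.1.2.2 ∧ s'.1.2.1 ≠ s.1.2.1 := by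
      rintro ⟨⟨p, b, q⟩, hb, hj⟩
      have hst := hself b hb
      have hbq : G.incidence q b * x b ≠ 0 := by
        refine mul_ne_zero ?_ hb
        rcases hj with ⟨h1, h2⟩ | ⟨h1, h2⟩
        · rw [incidence, if_neg (fun h => hst (h.trans h2.symm)), if_pos h2]
          norm_num
        · rw [incidence, if_pos h1, if_neg (fun h => hst (h1.trans h.symm))]
          norm_num
      obtain ⟨b', -, hb'q, hne'⟩ : ∃ b' ∈ Finset.univ, G.incidence q b' * x b' ≠ 0 ∧ b' ≠ b := by
        by_contra! hcon
        refine hbq ?_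
        rw [← hx q, Finset.sum_eq_single b (fun b' hb' hbb => ?_) (by simp)]
        by_contra h0
        exact hbb (hcon b' hb' h0)
      have hx' := right_ne_zero_of_mul hb'q
      have hinc := left_ne_zero_of_mul hb'q
      by_cases hs : G.src b'.1 b'.2 = q
      · exact ⟨⟨(q, b', G.tgt b'.1 b'.2), hx', Or.inl ⟨hs, rfl⟩⟩, rfl, hne'⟩
      · by_cases ht : G.tgt b'.1 b'.2 = q
        · exact ⟨⟨(q, b', G.src b'.1 b'.2), hx', Or.inr ⟨rfl, ht⟩⟩, rfl, hne'⟩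
        · simp [incidence, hs, ht] at hinc
    choose next hnext hback using step
    obtain ⟨b₀, hb₀⟩ := Function.ne_iff.1 hne
    let s : ℕ → State := fun i => next^[i]
      ⟨(G.src b₀.1 b₀.2, b₀, G.tgt b₀.1 b₀.2), hb₀, Or.inl ⟨rfl, rfl⟩⟩
    have hs : ∀ i, s (i + 1) = next (s i) := fun i => Function.iterate_succ_apply' next i _
    refine G.hasLoopOf_of_nonbacktracking (fun i => (s i).1.1) (fun i => (s i).1.2.1)
      (fun i => hT _ (s i).2.1) (fun i => ?_) (fun i => ?_)
    · rw [hs, hnext]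
      exact (s i).2.2
    · rw [hs]
      exact hback _

/-- The unit current around a loop. -/
lemma HasLoopOf.exists_isCirculation {G : CircuitGraph N B} {T : Set DeviceKind}
    (h : G.HasLoopOf T) :
    ∃ x : G.Branch → ℝ, G.IsCirculation x ∧ x ≠ 0 ∧ ∀ b, b.1 ∉ T → x b = 0 := by
  classical
  obtain ⟨S, ⟨n, v, b, -, hb, hj, rfl⟩, hT⟩ := h
  have hsign : ∀ k, ∃ s : ℝ, s ≠ 0 ∧ ∀ p, G.incidence p (b k) * s =
      (if v k = p then 1 else 0) - (if v (k + 1) = p then 1 else 0) := by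
    intro k
    rcases hj k with ⟨h1, h2⟩ | ⟨h1, h2⟩
    · exact ⟨1, one_ne_zero, fun p => by rw [incidence, h1, h2, mul_one]⟩
    · exact ⟨-1, by norm_num, fun p => by rw [incidence, h1, h2]; ring⟩
  choose s hs0 hs using hsign
  refine ⟨fun c => ∑ k, if b k = c then s k else 0, fun p => ?_, fun h0 => ?_, fun c hc => ?_⟩
  · simp_rw [Finset.mul_sum]
    rw [Finset.sum_comm]
    simp only [mul_ite, mul_zero, Finset.sum_ite_eq, Finset.mem_univ, if_true, hs,
      Finset.sum_sub_distrib]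
    rw [sub_eq_zero]
    exact (Equiv.sum_comp (Equiv.addRight (1 : Fin (n + 1)))
      (fun k => if v k = p then (1 : ℝ) else 0)).symm
  · have := congrFun h0 (b 0)
    simp only [hb.eq_iff, Finset.sum_ite_eq', Finset.mem_univ, if_true] at this
    exact hs0 0 this
  · refine Finset.sum_eq_zero fun k _ => if_neg ?_
    rintro rfl
    exact hc (hT _ ⟨k, rfl⟩)

/-- If all voltages outside the types `T` vanish and some potential does not, then the removal of
the branches of types `T` separates nodes, so that these branches contain a cutset. -/
lemma hasCutsetOf_of_transpose_mulVec_eq_zero [Fintype N] (G : CircuitGraph N B)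
    {T : Set DeviceKind} {e : G.NonRef → ℝ} (he : ∀ k, k ∉ T → (G.A k).transpose.mulVec e = 0) (hne : e ≠ 0) :
    G.HasCutsetOf T := by
  have hdis : ¬ G.ConnectedWithout {b | b.1 ∈ T} := by
    intro hcon
    refine hne (funext fun n => ?_)
    have hconst : ∀ x y, Relation.EqvGen
        (fun p q => ∃ b : G.Branch, b ∉ {b : G.Branch | b.1 ∈ T} ∧ G.Joins b p q) x y →
        G.extendPot e x = G.extendPot e y := by
      intro x y h
      induction h with
      | rel p q h =>
        obtain ⟨b, hb, hj⟩ := h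
        have h0 := G.transpose_mulVec_apply e b.1 b.2
        rw [he b.1 hb, Pi.zero_apply, eq_comm, sub_eq_zero] at h0
        rcases hj with ⟨h1, h2⟩ | ⟨h1, h2⟩
        · rw [← h1, ← h2, h0]
        · rw [← h1, ← h2, h0]
      | refl => rfl
      | symm _ _ _ ih => exact ih.symm
      | trans _ _ _ _ _ ih1 ih2 => exact ih1.trans ih2
    simpa [extendPot, n.2] using hconst n.1 G.ref (hcon _ _)
  obtain ⟨K, hKT, hK⟩ :=
    (Set.toFinite {K : Set G.Branch | ¬ G.ConnectedWithout K}).exists_le_minimal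
      (a := {b : G.Branch | b.1 ∈ T}) hdis
  refine ⟨K, ⟨hK.prop, fun K' hK' => ?_⟩, fun b hb => hKT hb⟩
  by_contra hcon
  exact hK.not_prop_of_lt hK' hcon

end CircuitGraph

/-! ### Linearisation of the nodal model -/

section Jacobian

variable {m n : Type*} [Fintype m] [Fintype n] [DecidableEq n]

lemma jacobian_mulVec (g : (n → ℝ) → (m → ℝ)) (x v : n → ℝ) :
    (jacobian g x).mulVec v = fderiv ℝ g x v := by
  rw [jacobian, ← Matrix.toLin'_apply, Matrix.toLin'_toMatrix']
  rfl

/-- The partial Jacobian with respect to the last variable is a restriction of the total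
derivative. -/
lemma fderiv_inr_apply {X : Type*} [NormedAddCommGroup X] [NormedSpace ℝ X]
    {g : X × (n → ℝ) → (m → ℝ)} (hg : Differentiable ℝ g) (a : X) (x v : n → ℝ) :
    fderiv ℝ g (a, x) (0, v) = (jacobian (fun y => g (a, y)) x).mulVec v := by
  have h : HasFDerivAt (fun y => g (a, y)) _ x :=
    (hg (a, x)).hasFDerivAt.comp x (hasFDerivAt_prodMk_right a x)
  rw [jacobian_mulVec, h.fderiv]
  simp

lemma fderiv_inr_inr_apply {X Y : Type*} [NormedAddCommGroup X] [NormedSpace ℝ X]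
    [NormedAddCommGroup Y] [NormedSpace ℝ Y] {g : X × Y × (n → ℝ) → (m → ℝ)}
    (hg : Differentiable ℝ g) (a : X) (b : Y) (x v : n → ℝ) :
    fderiv ℝ g (a, b, x) (0, 0, v) = (jacobian (fun y => g (a, b, y)) x).mulVec v := by
  have h : HasFDerivAt (fun y => g (a, b, y)) _ x :=
    (hg (a, b, x)).hasFDerivAt.comp x
      ((hasFDerivAt_prodMk_right a (b, x)).comp x (hasFDerivAt_prodMk_right b x))
  rw [jacobian_mulVec, h.fderiv]
  simp

end Jacobian

namespace CircuitGraph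

variable {N : Type*} {B : DeviceKind → Type*} [Fintype N] [DecidableEq N]
  [∀ k, Fintype (B k)]

section

variable (G : CircuitGraph N B) (z v : G.Idx → ℝ)

lemma contDiff_dyn (d : DynKind) : ContDiff ℝ 1 (fun z : G.Idx → ℝ => G.dyn z d) :=
  contDiff_pi.2 fun _ => contDiff_apply ..

lemma contDiff_cur (a : CurKind) : ContDiff ℝ 1 (fun z : G.Idx → ℝ => G.cur z a) :=
  contDiff_pi.2 fun _ => contDiff_apply ..

lemma contDiff_mulVec {m n : Type*} [Fintype m] [Fintype n] (M : Matrix m n ℝ)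
    {X : Type*} [NormedAddCommGroup X] [NormedSpace ℝ X] {g : X → n → ℝ} (hg : ContDiff ℝ 1 g) :
    ContDiff ℝ 1 (fun x => M.mulVec (g x)) :=
  (LinearMap.toContinuousLinearMap M.mulVecLin).contDiff.comp hg

lemma contDiff_volt (k : DeviceKind) : ContDiff ℝ 1 (fun z : G.Idx → ℝ => G.volt z k) :=
  contDiff_mulVec _ (contDiff_pi.2 fun _ => contDiff_apply ..)

/-! Derivatives along the line `s ↦ z + s • v`. -/

lemma hasDerivAt_line {ι : Type*} [Fintype ι] (z v : ι → ℝ) (i : ι) :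
    HasDerivAt (fun s : ℝ => (z + s • v) i) (v i) 0 := by
  simpa using ((hasDerivAt_id (0 : ℝ)).mul_const (v i)).const_add (z i)

lemma hasDerivAt_dyn (d : DynKind) :
    HasDerivAt (fun s : ℝ => G.dyn (z + s • v) d) (G.dyn v d) 0 :=
  hasDerivAt_pi.2 fun _ => hasDerivAt_line z v _

lemma hasDerivAt_cur (a : CurKind) :
    HasDerivAt (fun s : ℝ => G.cur (z + s • v) a) (G.cur v a) 0 :=
  hasDerivAt_pi.2 fun _ => hasDerivAt_line z v _

lemma hasDerivAt_mulVec {m n : Type*} [Fintype m] [Fintype n] (M : Matrix m n ℝ)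
    {g : ℝ → n → ℝ} {g' : n → ℝ} {s : ℝ} (hg : HasDerivAt g g' s) :
    HasDerivAt (fun s => M.mulVec (g s)) (M.mulVec g') s :=
  (LinearMap.toContinuousLinearMap M.mulVecLin).hasFDerivAt.comp_hasDerivAt s hg

lemma hasDerivAt_volt (k : DeviceKind) :
    HasDerivAt (fun s : ℝ => G.volt (z + s • v) k) (G.volt v k) 0 :=
  hasDerivAt_mulVec _ (hasDerivAt_pi.2 fun _ => hasDerivAt_line z v _)

/-- `HasFDerivAt.comp_hasDerivAt` for a curve whose value at the point is known only up to
rewriting. -/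
lemma hasDerivAt_comp {X Y : Type*} [NormedAddCommGroup X] [NormedSpace ℝ X]
    [NormedAddCommGroup Y] [NormedSpace ℝ Y] {g : X → Y} (hg : ContDiff ℝ 1 g) {c : ℝ → X}
    {c' x : X} (hc : HasDerivAt c c' 0) (hx : c 0 = x) :
    HasDerivAt (fun s => g (c s)) (fderiv ℝ g x c') 0 := by
  subst hx
  exact ((hg.differentiable one_ne_zero _).hasFDerivAt).comp_hasDerivAt 0 hc

end

variable (G : CircuitGraph N B) (D : Characteristics B)

lemma contDiff_nodalRHS (t : ℝ) : ContDiff ℝ 1 (fun z => G.nodalRHS D z t) := by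
  have hV := G.contDiff_volt
  have hI := G.contDiff_cur
  have hX := G.contDiff_dyn
  have hV' := fun k => contDiff_pi.1 (hV k)
  have hI' := fun a => contDiff_pi.1 (hI a)
  have hX' := fun d => contDiff_pi.1 (hX d)
  refine contDiff_pi.2 ?_
  rintro (⟨d, b⟩ | n | ⟨a, b⟩)
  · cases d
    exacts [hI' .ic b, hI' .imc b, hV' .l b, hV' .ml b, hI' .im b, hI' .iml b, hI' .ihm b,
      hI' .ihw b, hV' .w b, hV' .mc b, hV' .hm b, hV' .hw b]
  · have h := ((((((((((((contDiff_mulVec (G.A .c) (hI .ic)).add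
      (contDiff_mulVec (G.A .mc) (hI .imc))).add
      (contDiff_mulVec (G.A .u) (hI .iu))).add (contDiff_mulVec (G.A .l) (hI .il))).add
      (contDiff_mulVec (G.A .ml) (hI .iml))).add
      (contDiff_mulVec (G.A .g) (D.γg_C1.comp (hV .g)))).add
      (contDiff_mulVec (G.A .w) (D.ζ_C1.comp ((hX .φw).prodMk (hV .w))))).add
      (contDiff_mulVec (G.A .r) (hI .ir))).add (contDiff_mulVec (G.A .m) (hI .im))).add
      (contDiff_mulVec (G.A .hm) (hI .ihm))).add (contDiff_mulVec (G.A .hw) (hI .ihw))).add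
      (contDiff_const (c := (G.A .j).mulVec (D.is t))))
    exact contDiff_pi.1 h n
  · cases a
    · exact (hX' .qc b).sub (contDiff_pi.1 (D.γc_C1.comp (hV .c)) b)
    · exact (hX' .qmc b).sub (contDiff_pi.1 (D.ω_C1.comp ((hX .φmc).prodMk (hV .mc))) b)
    · exact contDiff_const.sub (hV' .u b)
    · exact (hX' .φl b).sub (contDiff_pi.1 (D.γl_C1.comp (hI .il)) b)
    · exact (hX' .φml b).sub (contDiff_pi.1 (D.θ_C1.comp ((hX .qml).prodMk (hI .iml))) b)
    · exact (contDiff_pi.1 (D.γr_C1.comp (hI .ir)) b).sub (hV' .r b)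
    · exact (contDiff_pi.1 (D.η_C1.comp ((hX .qm).prodMk (hI .im))) b).sub (hV' .m b)
    · exact (contDiff_pi.1 (D.ψ_C1.comp ((hX .qhm).prodMk ((hX .φhm).prodMk (hI .ihm)))) b).sub
        (hV' .hm b)
    · exact (hI' .ihw b).sub
        (contDiff_pi.1 (D.ξ_C1.comp ((hX .qhw).prodMk ((hX .φhw).prodMk (hV .hw)))) b)

variable [∀ k, DecidableEq (B k)]

/-- The characteristics of the linearised circuit at the state `z`: each characteristic is replaced
by its derivative and all sources are switched off. -/
noncomputable def linearize (z : G.Idx → ℝ) :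
    Characteristics B where
  γc := fderiv ℝ D.γc (G.volt z .c)
  γl := fderiv ℝ D.γl (G.cur z .il)
  γr := fderiv ℝ D.γr (G.cur z .ir)
  γg := fderiv ℝ D.γg (G.volt z .g)
  η q i := fderiv ℝ (fun p : (B .m → ℝ) × (B .m → ℝ) => D.η p.1 p.2)
    (G.dyn z .qm, G.cur z .im) (q, i)
  ζ φ v := fderiv ℝ (fun p : (B .w → ℝ) × (B .w → ℝ) => D.ζ p.1 p.2)
    (G.dyn z .φw, G.volt z .w) (φ, v)
  ω φ v := fderiv ℝ (fun p : (B .mc → ℝ) × (B .mc → ℝ) => D.ω p.1 p.2)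
    (G.dyn z .φmc, G.volt z .mc) (φ, v)
  θ q i := fderiv ℝ (fun p : (B .ml → ℝ) × (B .ml → ℝ) => D.θ p.1 p.2)
    (G.dyn z .qml, G.cur z .iml) (q, i)
  ψ q φ i := fderiv ℝ (fun p : (B .hm → ℝ) × (B .hm → ℝ) × (B .hm → ℝ) => D.ψ p.1 p.2.1 p.2.2)
    (G.dyn z .qhm, G.dyn z .φhm, G.cur z .ihm) (q, φ, i)
  ξ q φ v := fderiv ℝ (fun p : (B .hw → ℝ) × (B .hw → ℝ) × (B .hw → ℝ) => D.ξ p.1 p.2.1 p.2.2)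
    (G.dyn z .qhw, G.dyn z .φhw, G.volt z .hw) (q, φ, v)
  vs _ := 0
  is _ := 0
  γc_C1 := ContinuousLinearMap.contDiff _
  γl_C1 := ContinuousLinearMap.contDiff _
  γr_C1 := ContinuousLinearMap.contDiff _
  γg_C1 := ContinuousLinearMap.contDiff _
  η_C1 := ContinuousLinearMap.contDiff _
  ζ_C1 := ContinuousLinearMap.contDiff _
  ω_C1 := ContinuousLinearMap.contDiff _
  θ_C1 := ContinuousLinearMap.contDiff _
  ψ_C1 := ContinuousLinearMap.contDiff _
  ξ_C1 := ContinuousLinearMap.contDiff _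

/-- The linear map `f_z (z, t)` is the right-hand side of the nodal model of the linearised
circuit. -/
lemma jacobian_nodalRHS_mulVec (z v : G.Idx → ℝ) (t : ℝ) :
    (jacobian (fun y => G.nodalRHS D y t) z).mulVec v = G.nodalRHS (G.linearize D z) v 0 := by
  rw [jacobian_mulVec]
  have hV := G.hasDerivAt_volt z v
  have hI := G.hasDerivAt_cur z v
  have hX := G.hasDerivAt_dyn z v
  have hV' := fun k => hasDerivAt_pi.1 (hV k)
  have hI' := fun a => hasDerivAt_pi.1 (hI a)
  have hX' := fun d => hasDerivAt_pi.1 (hX d)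
  have hz : z + (0 : ℝ) • v = z := by simp
  have hline : HasDerivAt (fun s : ℝ => z + s • v) v 0 :=
    hasDerivAt_pi.2 (hasDerivAt_line z v)
  refine (hasDerivAt_comp (G.contDiff_nodalRHS D t) hline hz).unique (hasDerivAt_pi.2 ?_)
  rintro (⟨d, b⟩ | n | ⟨a, b⟩)
  · cases d
    exacts [hI' .ic b, hI' .imc b, hV' .l b, hV' .ml b, hI' .im b, hI' .iml b, hI' .ihm b,
      hI' .ihw b, hV' .w b, hV' .mc b, hV' .hm b, hV' .hw b]
  · have h := ((((((((((((hasDerivAt_mulVec (G.A .c) (hI .ic)).add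
      (hasDerivAt_mulVec (G.A .mc) (hI .imc))).add
      (hasDerivAt_mulVec (G.A .u) (hI .iu))).add (hasDerivAt_mulVec (G.A .l) (hI .il))).add
      (hasDerivAt_mulVec (G.A .ml) (hI .iml))).add
      (hasDerivAt_mulVec (G.A .g) (hasDerivAt_comp D.γg_C1 (hV .g) (by rw [hz])))).add
      (hasDerivAt_mulVec (G.A .w)
        (hasDerivAt_comp D.ζ_C1 ((hX .φw).prodMk (hV .w)) (by rw [hz])))).add
      (hasDerivAt_mulVec (G.A .r) (hI .ir))).add (hasDerivAt_mulVec (G.A .m) (hI .im))).add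
      (hasDerivAt_mulVec (G.A .hm) (hI .ihm))).add (hasDerivAt_mulVec (G.A .hw) (hI .ihw))).add
      (hasDerivAt_mulVec (G.A .j) (hasDerivAt_const (0 : ℝ) (D.is t))))
    exact hasDerivAt_pi.1 h n
  · cases a
    · exact (hX' .qc b).sub
        (hasDerivAt_pi.1 (hasDerivAt_comp D.γc_C1 (hV .c) (by rw [hz])) b)
    · exact (hX' .qmc b).sub (hasDerivAt_pi.1
        (hasDerivAt_comp D.ω_C1 ((hX .φmc).prodMk (hV .mc)) (by rw [hz])) b)
    · exact (hasDerivAt_const (0 : ℝ) (D.vs t b)).sub (hV' .u b)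
    · exact (hX' .φl b).sub
        (hasDerivAt_pi.1 (hasDerivAt_comp D.γl_C1 (hI .il) (by rw [hz])) b)
    · exact (hX' .φml b).sub (hasDerivAt_pi.1
        (hasDerivAt_comp D.θ_C1 ((hX .qml).prodMk (hI .iml)) (by rw [hz])) b)
    · exact (hasDerivAt_pi.1 (hasDerivAt_comp D.γr_C1 (hI .ir) (by rw [hz])) b).sub (hV' .r b)
    · exact (hasDerivAt_pi.1
        (hasDerivAt_comp D.η_C1 ((hX .qm).prodMk (hI .im)) (by rw [hz])) b).sub (hV' .m b)
    · exact (hasDerivAt_pi.1 (hasDerivAt_comp D.ψ_C1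
        ((hX .qhm).prodMk ((hX .φhm).prodMk (hI .ihm))) (by rw [hz])) b).sub (hV' .hm b)
    · exact (hI' .ihw b).sub (hasDerivAt_pi.1 (hasDerivAt_comp D.ξ_C1
        ((hX .qhw).prodMk ((hX .φhw).prodMk (hV .hw))) (by rw [hz])) b)

end CircuitGraph

/-! ### The degenerate modes of a circuit -/

namespace CircuitGraph

variable {N : Type*} {B : DeviceKind → Type*} [Fintype N] [DecidableEq N]

lemma pot_dotProduct_mulVec [∀ k, Fintype (B k)] (G : CircuitGraph N B) (z : G.Idx → ℝ)
    (k : DeviceKind) (x : B k → ℝ) :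
    G.pot z ⬝ᵥ (G.A k).mulVec x = G.volt z k ⬝ᵥ x := by
  rw [volt, Matrix.dotProduct_mulVec, Matrix.mulVec_transpose]

variable [∀ k, Fintype (B k)] (G : CircuitGraph N B)

/-- The modes that make the algebraic part of the nodal model singular, `ker F₂₂` in block form
`E = block-diag(I, 0)`: currents that circulate in loops of voltage sources, capacitors and
memcapacitors, together with node potentials that only cutsets of current sources, inductors and
meminductors support. No incremental matrix enters. -/
structure IsDegenerateMode (w : G.Idx → ℝ) : Prop where
  dyn_eq_zero : ∀ d, G.dyn w d = 0
  volt_eq_zero : ∀ k, k ∉ ({.j, .l, .ml} : Set DeviceKind) → G.volt w k = 0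
  cur_eq_zero : ∀ a, a ∉ ({.ic, .imc, .iu} : Set CurKind) → G.cur w a = 0
  circulation : (G.A .c).mulVec (G.cur w .ic) + (G.A .mc).mulVec (G.cur w .imc)
    + (G.A .u).mulVec (G.cur w .iu) = 0

variable {G}

lemma TopologicallyDegenerate.exists_isDegenerateMode (h : G.TopologicallyDegenerate) :
    ∃ w, w ≠ 0 ∧ G.IsDegenerateMode w := by
  rcases h with h | h
  · obtain ⟨x, hx, hne, hT⟩ := h.exists_isCirculation
    let w : G.Idx → ℝ := Sum.elim 0 (Sum.elim 0 fun p => x ⟨p.1.device, p.2⟩)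
    have hpot : G.pot w = 0 := rfl
    refine ⟨w, fun hw => hne (funext fun b => ?_),
      ⟨fun d => rfl, fun k _ => by rw [volt, hpot, Matrix.mulVec_zero], fun a ha => ?_, ?_⟩⟩
    · by_contra hb
      obtain ⟨k, b⟩ := b
      have hk : k ∈ ({.u, .c, .mc} : Set DeviceKind) := by
        by_contra hk
        exact hb (hT _ hk)
      rcases hk with rfl | rfl | rfl
      · exact hb (congrFun hw (.inr (.inr ⟨.iu, b⟩)))
      · exact hb (congrFun hw (.inr (.inr ⟨.ic, b⟩)))
      · exact hb (congrFun hw (.inr (.inr ⟨.imc, b⟩)))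
    · funext b
      refine hT ⟨a.device, b⟩ ?_
      cases a <;> simp at ha ⊢
    · have hsum := (G.isCirculation_iff x).1 hx
      rw [← Finset.sum_subset (Finset.subset_univ {.c, .mc, .u})] at hsum
      · rw [Finset.sum_insert (by simp), Finset.sum_insert (by simp), Finset.sum_singleton,
          ← add_assoc] at hsum
        exact hsum
      · intro k _ hk
        have : (fun b => x ⟨k, b⟩) = 0 := funext fun b => hT ⟨k, b⟩ (by simp at hk ⊢; tauto)
        rw [this, Matrix.mulVec_zero]
  · obtain ⟨e, hne, he⟩ := h.exists_pot
    let w : G.Idx → ℝ := Sum.elim 0 (Sum.elim e 0)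
    have hcur : ∀ a, G.cur w a = 0 := fun a => rfl
    refine ⟨w, fun hw => hne (funext fun n => congrFun hw (.inr (.inl n))),
      ⟨fun d => rfl, he, fun a _ => hcur a, ?_⟩⟩
    simp only [hcur, Matrix.mulVec_zero, add_zero]

lemma eq_zero_of_mulVec_eq_zero_of_not_hasLoopOf {k : DeviceKind} (h : ¬ G.HasLoopOf {k})
    {i : B k → ℝ} (hi : (G.A k).mulVec i = 0) : i = 0 := by
  let x : G.Branch → ℝ := fun b => if hb : b.1 = k then i (hb ▸ b.2) else 0
  have hxk : ∀ b, x ⟨k, b⟩ = i b := fun b => dif_pos rfl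
  by_contra hne
  refine h (IsCirculation.hasLoopOf (x := x) ?_ ?_ fun hx => hne (funext fun b => ?_))
  · rw [isCirculation_iff, Finset.sum_eq_single k _ (by simp)]
    · simpa only [hxk] using hi
    · intro k' _ hk'
      have : (fun b => x ⟨k', b⟩) = 0 := funext fun b => dif_neg hk'
      rw [this, Matrix.mulVec_zero]
  · intro b hb
    by_contra hbk
    exact hb (dif_neg hbk)
  · rw [← hxk, hx]
    rfl

/-- In a well-posed circuit a mode without capacitive currents and inductive voltages is trivial. -/
lemma IsDegenerateMode.eq_zero {w : G.Idx → ℝ} (hw : G.IsDegenerateMode w)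
    (hVloop : ¬ G.HasLoopOf {DeviceKind.u}) (hIcutset : ¬ G.HasCutsetOf {DeviceKind.j})
    (hc : G.cur w .ic = 0) (hmc : G.cur w .imc = 0) (hl : G.volt w .l = 0)
    (hml : G.volt w .ml = 0) : w = 0 := by
  have hu : G.cur w .iu = 0 := by
    refine eq_zero_of_mulVec_eq_zero_of_not_hasLoopOf hVloop ?_
    have := hw.circulation
    rwa [hc, hmc, Matrix.mulVec_zero, Matrix.mulVec_zero, add_zero, zero_add] at this
  have he : G.pot w = 0 := by
    by_contra hne
    refine hIcutset (G.hasCutsetOf_of_transpose_mulVec_eq_zero (e := G.pot w) (fun k hk => ?_) hne)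
    by_cases hk1 : k = .l
    · subst hk1
      exact hl
    by_cases hk2 : k = .ml
    · subst hk2
      exact hml
    exact hw.volt_eq_zero k (by simp_all)
  have hcur : ∀ a, G.cur w a = 0 := by
    intro a
    by_cases ha : a ∈ ({.ic, .imc, .iu} : Set CurKind)
    · rcases ha with rfl | rfl | rfl
      exacts [hc, hmc, hu]
    · exact hw.cur_eq_zero a ha
  funext i
  rcases i with ⟨d, b⟩ | n | ⟨a, b⟩
  · exact congrFun (hw.dyn_eq_zero d) b
  · exact congrFun he n
  · exact congrFun (hcur a) b

end CircuitGraph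

/-! ### Strict passivity -/

/-- A (linear) characteristic that vanishes at zero and dissipates power everywhere else. -/
def IsStrictlyPassive {n : Type*} [Fintype n] (g : (n → ℝ) → (n → ℝ)) : Prop :=
  g 0 = 0 ∧ ∀ x, x ≠ 0 → 0 < x ⬝ᵥ g x

namespace IsStrictlyPassive

variable {n : Type*} [Fintype n] {g : (n → ℝ) → (n → ℝ)}

lemma dotProduct_nonneg (h : IsStrictlyPassive g) (x : n → ℝ) : 0 ≤ x ⬝ᵥ g x := by
  by_cases hx : x = 0
  · simp [hx]
  · exact (h.2 x hx).le

lemma eq_zero_of_dotProduct (h : IsStrictlyPassive g) {x : n → ℝ} (hx : x ⬝ᵥ g x = 0) :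
    x = 0 := by
  by_contra hne
  exact (h.2 x hne).ne' hx

lemma eq_zero_of_apply (h : IsStrictlyPassive g) {x : n → ℝ} (hx : g x = 0) : x = 0 :=
  h.eq_zero_of_dotProduct (by rw [hx, dotProduct_zero])

end IsStrictlyPassive

/-- The sources are switched off and the characteristics are strictly passive, as functions of the
current or voltage variable, when the memory variables (the other arguments) vanish. -/
structure Characteristics.IsPassive {B : DeviceKind → Type*} [∀ k, Fintype (B k)]
    (K : Characteristics B) : Prop where
  c : IsStrictlyPassive K.γc
  l : IsStrictlyPassive K.γl
  r : IsStrictlyPassive K.γr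
  g : IsStrictlyPassive K.γg
  m : IsStrictlyPassive (K.η 0)
  w : IsStrictlyPassive (K.ζ 0)
  mc : IsStrictlyPassive (K.ω 0)
  ml : IsStrictlyPassive (K.θ 0)
  hm : IsStrictlyPassive (K.ψ 0 0)
  hw : IsStrictlyPassive (K.ξ 0 0)
  vs : ∀ t, K.vs t = 0
  is : ∀ t, K.is t = 0

namespace CircuitGraph

variable {N : Type*} {B : DeviceKind → Type*} [Fintype N] [DecidableEq N]
  [∀ k, Fintype (B k)]

lemma isPassive_linearize [∀ k, DecidableEq (B k)] (G : CircuitGraph N B)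
    (D : Characteristics B) (z : G.Idx → ℝ)
    (hC : IsPositiveDefinite (G.capacitance D z))
    (hCm : IsPositiveDefinite (G.memcapacitance D z))
    (hL : IsPositiveDefinite (G.inductance D z))
    (hLm : IsPositiveDefinite (G.meminductance D z))
    (hR : IsPositiveDefinite (G.resistance D z))
    (hG : IsPositiveDefinite (G.conductance D z))
    (hM : IsPositiveDefinite (G.memristance D z))
    (hMh : IsPositiveDefinite (G.hybridMemristance D z))
    (hW : IsPositiveDefinite (G.memductance D z))
    (hWh : IsPositiveDefinite (G.hybridMemductance D z)) :
    (G.linearize D z).IsPassive := by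
  have aux : ∀ {n : Type _} [Fintype n] [DecidableEq n] {M : Matrix n n ℝ}
      {g : (n → ℝ) → (n → ℝ)}, IsPositiveDefinite M → (∀ x, g x = M.mulVec x) →
      IsStrictlyPassive g := fun hM hg =>
    ⟨by rw [hg, Matrix.mulVec_zero], fun x hx => by rw [hg]; exact hM x hx⟩
  exact
  { c := aux hC fun x => (jacobian_mulVec _ _ x).symm
    l := aux hL fun x => (jacobian_mulVec _ _ x).symm
    r := aux hR fun x => (jacobian_mulVec _ _ x).symm
    g := aux hG fun x => (jacobian_mulVec _ _ x).symm
    m := aux hM fun x => fderiv_inr_apply (D.η_C1.differentiable one_ne_zero) _ _ x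
    w := aux hW fun x => fderiv_inr_apply (D.ζ_C1.differentiable one_ne_zero) _ _ x
    mc := aux hCm fun x => fderiv_inr_apply (D.ω_C1.differentiable one_ne_zero) _ _ x
    ml := aux hLm fun x => fderiv_inr_apply (D.θ_C1.differentiable one_ne_zero) _ _ x
    hm := aux hMh fun x => fderiv_inr_inr_apply (D.ψ_C1.differentiable one_ne_zero) _ _ _ x
    hw := aux hWh fun x => fderiv_inr_inr_apply (D.ξ_C1.differentiable one_ne_zero) _ _ _ x
    vs := fun _ => rfl
    is := fun _ => rfl }

/-! ### The algebraic equations of a passive circuit -/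

section

variable {G : CircuitGraph N B} {K : Characteristics B}

/-- The algebraic part of the nodal model, as equations between vectors. -/
lemma nodalRHS_inr_eq_zero_iff {z : G.Idx → ℝ} {t : ℝ} :
    (∀ i, G.nodalRHS K z t (.inr i) = 0) ↔
      ((G.A .c).mulVec (G.cur z .ic) + (G.A .mc).mulVec (G.cur z .imc)
        + (G.A .u).mulVec (G.cur z .iu) + (G.A .l).mulVec (G.cur z .il)
        + (G.A .ml).mulVec (G.cur z .iml)
        + (G.A .g).mulVec (K.γg (G.volt z .g))
        + (G.A .w).mulVec (K.ζ (G.dyn z .φw) (G.volt z .w))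
        + (G.A .r).mulVec (G.cur z .ir) + (G.A .m).mulVec (G.cur z .im)
        + (G.A .hm).mulVec (G.cur z .ihm) + (G.A .hw).mulVec (G.cur z .ihw)
        + (G.A .j).mulVec (K.is t) = 0) ∧
      G.dyn z .qc = K.γc (G.volt z .c) ∧
      G.dyn z .qmc = K.ω (G.dyn z .φmc) (G.volt z .mc) ∧
      K.vs t = G.volt z .u ∧
      G.dyn z .φl = K.γl (G.cur z .il) ∧
      G.dyn z .φml = K.θ (G.dyn z .qml) (G.cur z .iml) ∧
      K.γr (G.cur z .ir) = G.volt z .r ∧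
      K.η (G.dyn z .qm) (G.cur z .im) = G.volt z .m ∧
      K.ψ (G.dyn z .qhm) (G.dyn z .φhm) (G.cur z .ihm) = G.volt z .hm ∧
      G.cur z .ihw = K.ξ (G.dyn z .qhw) (G.dyn z .φhw) (G.volt z .hw) := by
  constructor
  · intro h
    exact ⟨funext fun n => h (.inl n), funext fun b => sub_eq_zero.1 (h (.inr ⟨.ic, b⟩)),
      funext fun b => sub_eq_zero.1 (h (.inr ⟨.imc, b⟩)),
      funext fun b => sub_eq_zero.1 (h (.inr ⟨.iu, b⟩)),
      funext fun b => sub_eq_zero.1 (h (.inr ⟨.il, b⟩)),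
      funext fun b => sub_eq_zero.1 (h (.inr ⟨.iml, b⟩)),
      funext fun b => sub_eq_zero.1 (h (.inr ⟨.ir, b⟩)),
      funext fun b => sub_eq_zero.1 (h (.inr ⟨.im, b⟩)),
      funext fun b => sub_eq_zero.1 (h (.inr ⟨.ihm, b⟩)),
      funext fun b => sub_eq_zero.1 (h (.inr ⟨.ihw, b⟩))⟩
  · rintro ⟨h, hc, hmc, hu, hl, hml, hr, hm, hhm, hhw⟩ (n | ⟨a, b⟩)
    · exact congrFun h n
    · cases a
      exacts [sub_eq_zero.2 (congrFun hc b), sub_eq_zero.2 (congrFun hmc b),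
        sub_eq_zero.2 (congrFun hu b), sub_eq_zero.2 (congrFun hl b),
        sub_eq_zero.2 (congrFun hml b), sub_eq_zero.2 (congrFun hr b),
        sub_eq_zero.2 (congrFun hm b), sub_eq_zero.2 (congrFun hhm b),
        sub_eq_zero.2 (congrFun hhw b)]

/-- Tellegen's theorem: pair the current law with `pot w`. The reactive branches carry no power, so
that every resistive device dissipates none. -/
lemma _root_.Characteristics.IsPassive.isDegenerateMode (hK : K.IsPassive) {w : G.Idx → ℝ} {t : ℝ}
    (hw : ∀ d, G.dyn w d = 0) (h : ∀ i, G.nodalRHS K w t (.inr i) = 0) :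
    G.IsDegenerateMode w := by
  obtain ⟨hkcl, hc, hmc, hu, hl, hml, hr, hm, hhm, hhw⟩ := nodalRHS_inr_eq_zero_iff.1 h
  simp only [hw, hK.vs, hK.is, Matrix.mulVec_zero, add_zero] at hkcl hc hmc hu hl hml hm hhm hhw
  have vc := hK.c.eq_zero_of_apply hc.symm
  have vmc := hK.mc.eq_zero_of_apply hmc.symm
  have il := hK.l.eq_zero_of_apply hl.symm
  have iml := hK.ml.eq_zero_of_apply hml.symm
  have hpow := congrArg (fun x => G.pot w ⬝ᵥ x) hkcl
  simp only [dotProduct_add, pot_dotProduct_mulVec, vc, vmc, ← hu, il, iml, zero_dotProduct,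
    dotProduct_zero, zero_add, ← hr, ← hm, ← hhm, hhw] at hpow
  rw [dotProduct_comm (K.γr _), dotProduct_comm (K.η 0 _), dotProduct_comm (K.ψ 0 0 _)] at hpow
  have pg := hK.g.dotProduct_nonneg (G.volt w .g)
  have pw := hK.w.dotProduct_nonneg (G.volt w .w)
  have pr := hK.r.dotProduct_nonneg (G.cur w .ir)
  have pm := hK.m.dotProduct_nonneg (G.cur w .im)
  have phm := hK.hm.dotProduct_nonneg (G.cur w .ihm)
  have phw := hK.hw.dotProduct_nonneg (G.volt w .hw)
  have vg : G.volt w .g = 0 := hK.g.eq_zero_of_dotProduct (by linarith)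
  have vw : G.volt w .w = 0 := hK.w.eq_zero_of_dotProduct (by linarith)
  have ir : G.cur w .ir = 0 := hK.r.eq_zero_of_dotProduct (by linarith)
  have im : G.cur w .im = 0 := hK.m.eq_zero_of_dotProduct (by linarith)
  have ihm : G.cur w .ihm = 0 := hK.hm.eq_zero_of_dotProduct (by linarith)
  have vhw : G.volt w .hw = 0 := hK.hw.eq_zero_of_dotProduct (by linarith)
  rw [vhw, hK.hw.1] at hhw
  rw [ir, hK.r.1] at hr
  rw [im, hK.m.1] at hm
  rw [ihm, hK.hm.1] at hhm
  refine ⟨hw, fun k hk => ?_, fun a ha => ?_, ?_⟩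
  · cases k
    case c => exact vc
    case mc => exact vmc
    case u => exact hu.symm
    case g => exact vg
    case w => exact vw
    case r => exact hr.symm
    case m => exact hm.symm
    case hm => exact hhm.symm
    case hw => exact vhw
    all_goals simp at hk
  · cases a
    case il => exact il
    case iml => exact iml
    case ir => exact ir
    case im => exact im
    case ihm => exact ihm
    case ihw => exact hhw
    all_goals simp at ha
  · simpa only [il, iml, vg, vw, ir, im, ihm, hhw, hK.g.1, hK.w.1, Matrix.mulVec_zero,
      add_zero] using hkcl

lemma IsDegenerateMode.nodalRHS_inr_eq_zero {w : G.Idx → ℝ} (hw : G.IsDegenerateMode w)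
    (hK : K.IsPassive) (t : ℝ) (i : G.AlgIdx) : G.nodalRHS K w t (.inr i) = 0 := by
  refine nodalRHS_inr_eq_zero_iff.2 ?_ i
  have hV : ∀ k, k ∉ ({.j, .l, .ml} : Set DeviceKind) → G.volt w k = 0 := hw.volt_eq_zero
  have hI := hw.cur_eq_zero
  have hcirc := hw.circulation
  simp only [hw.dyn_eq_zero, hV .c (by simp), hV .mc (by simp), hV .u (by simp), hV .g (by simp),
    hV .w (by simp), hV .r (by simp), hV .m (by simp), hV .hm (by simp), hV .hw (by simp),
    hI .il (by simp), hI .iml (by simp), hI .ir (by simp), hI .im (by simp), hI .ihm (by simp),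
    hI .ihw (by simp), hK.vs, hK.is, hK.c.1, hK.l.1, hK.r.1, hK.g.1, hK.m.1, hK.w.1, hK.mc.1,
    hK.ml.1, hK.hm.1, hK.hw.1, Matrix.mulVec_zero, add_zero, hcirc, and_self]

/-- The regularity behind index two. Let `p` be a state whose dynamic part is the velocity of a
degenerate mode `w` and which satisfies the algebraic equations. Pairing the circulation of `w` with
the potentials of `p` shows that the (mem)capacitors carry no current in `w`; pairing the current
law of `p` with the potentials of `w` shows that the (mem)inductors have no voltage in `w`. -/
lemma IsDegenerateMode.eq_zero_of_velocity {w p : G.Idx → ℝ} {t s : ℝ}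
    (hw : G.IsDegenerateMode w) (hK : K.IsPassive)
    (hVloop : ¬ G.HasLoopOf {DeviceKind.u}) (hIcutset : ¬ G.HasCutsetOf {DeviceKind.j})
    (hp : ∀ i, p (.inl i) = G.nodalRHS K w t (.inl i))
    (h : ∀ i, G.nodalRHS K p s (.inr i) = 0) : w = 0 := by
  have hV : ∀ k, k ∉ ({.j, .l, .ml} : Set DeviceKind) → G.volt w k = 0 := hw.volt_eq_zero
  have hI := hw.cur_eq_zero
  have dqc : G.dyn p .qc = G.cur w .ic := funext fun b => hp ⟨.qc, b⟩
  have dqmc : G.dyn p .qmc = G.cur w .imc := funext fun b => hp ⟨.qmc, b⟩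
  have dφl : G.dyn p .φl = G.volt w .l := funext fun b => hp ⟨.φl, b⟩
  have dφml : G.dyn p .φml = G.volt w .ml := funext fun b => hp ⟨.φml, b⟩
  have dqml : G.dyn p .qml = 0 :=
    (funext fun b => hp ⟨.qml, b⟩ : G.dyn p .qml = G.cur w .iml).trans (hI .iml (by simp))
  have dφmc : G.dyn p .φmc = 0 :=
    (funext fun b => hp ⟨.φmc, b⟩ : G.dyn p .φmc = G.volt w .mc).trans (hV .mc (by simp))
  obtain ⟨hkcl, hc, hmc, hu, hl, hml, -, -, -, -⟩ := nodalRHS_inr_eq_zero_iff.1 h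
  rw [dqc] at hc
  rw [dqmc, dφmc] at hmc
  rw [dφl] at hl
  rw [dφml, dqml] at hml
  rw [hK.vs] at hu
  have hpow := congrArg (fun x => G.pot p ⬝ᵥ x) hw.circulation
  simp only [dotProduct_add, pot_dotProduct_mulVec, ← hu, hc, hmc, zero_dotProduct,
    dotProduct_zero, add_zero] at hpow
  have pc := hK.c.dotProduct_nonneg (G.volt p .c)
  have pmc := hK.mc.dotProduct_nonneg (G.volt p .mc)
  rw [hK.c.eq_zero_of_dotProduct (by linarith : G.volt p .c ⬝ᵥ _ = 0), hK.c.1] at hc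
  rw [hK.mc.eq_zero_of_dotProduct (by linarith : G.volt p .mc ⬝ᵥ _ = 0), hK.mc.1] at hmc
  have hpow' := congrArg (fun x => G.pot w ⬝ᵥ x) hkcl
  simp only [dotProduct_add, pot_dotProduct_mulVec, hK.is, hV .c (by simp), hV .mc (by simp),
    hV .u (by simp), hV .g (by simp), hV .w (by simp), hV .r (by simp), hV .m (by simp),
    hV .hm (by simp), hV .hw (by simp), hl, hml, zero_dotProduct, dotProduct_zero, add_zero,
    zero_add] at hpow'
  rw [dotProduct_comm (K.γl _), dotProduct_comm (K.θ 0 _)] at hpow'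
  have pl := hK.l.dotProduct_nonneg (G.cur p .il)
  have pml := hK.ml.dotProduct_nonneg (G.cur p .iml)
  rw [hK.l.eq_zero_of_dotProduct (by linarith : G.cur p .il ⬝ᵥ _ = 0), hK.l.1] at hl
  rw [hK.ml.eq_zero_of_dotProduct (by linarith : G.cur p .iml ⬝ᵥ _ = 0), hK.ml.1] at hml
  exact hw.eq_zero hVloop hIcutset hc hmc hl hml

end

/-! ### The index of the nodal model -/

section

variable [∀ k, DecidableEq (B k)] {G : CircuitGraph N B}

lemma nodalE_mulVec_eq_zero_iff {v : G.Idx → ℝ} :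
    G.nodalE.mulVec v = 0 ↔ ∀ i, v (.inl i) = 0 := by
  simp [nodalE, Matrix.fromBlocks_mulVec, funext_iff]

lemma nodalE_mulVec_eq_self_iff {v : G.Idx → ℝ} :
    G.nodalE.mulVec v = v ↔ ∀ i, v (.inr i) = 0 := by
  simp [nodalE, Matrix.fromBlocks_mulVec, funext_iff, eq_comm]

lemma nodalE_mul_self : G.nodalE * G.nodalE = G.nodalE := by
  simp [nodalE, Matrix.fromBlocks_multiply]

end

end CircuitGraph

theorem theorem2 {N : Type*} {B : DeviceKind → Type*} [Fintype N] [DecidableEq N]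
    [∀ k, Fintype (B k)] [∀ k, DecidableEq (B k)]
    (G : CircuitGraph N B) (D : Characteristics B)
    (hconn : G.Connected)
    (hVloop : ¬ G.HasLoopOf {DeviceKind.u})
    (hIcutset : ¬ G.HasCutsetOf {DeviceKind.j})
    (hdeg : G.TopologicallyDegenerate)
    (Ω : Set (G.Idx → ℝ))
    (hC : ∀ z ∈ Ω, IsPositiveDefinite (G.capacitance D z))
    (hCm : ∀ z ∈ Ω, IsPositiveDefinite (G.memcapacitance D z))
    (hL : ∀ z ∈ Ω, IsPositiveDefinite (G.inductance D z))
    (hLm : ∀ z ∈ Ω, IsPositiveDefinite (G.meminductance D z))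
    (hR : ∀ z ∈ Ω, IsPositiveDefinite (G.resistance D z))
    (hG : ∀ z ∈ Ω, IsPositiveDefinite (G.conductance D z))
    (hM : ∀ z ∈ Ω, IsPositiveDefinite (G.memristance D z))
    (hMh : ∀ z ∈ Ω, IsPositiveDefinite (G.hybridMemristance D z))
    (hW : ∀ z ∈ Ω, IsPositiveDefinite (G.memductance D z))
    (hWh : ∀ z ∈ Ω, IsPositiveDefinite (G.hybridMemductance D z)) :
    HasTractabilityIndexTwo G.nodalE (G.nodalRHS D) Ω := by
  have hK : ∀ z ∈ Ω, (G.linearize D z).IsPassive := fun z hz =>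
    G.isPassive_linearize D z (hC z hz) (hCm z hz) (hL z hz) (hLm z hz) (hR z hz) (hG z hz)
      (hM z hz) (hMh z hz) (hW z hz) (hWh z hz)
  have hmode : ∀ z ∈ Ω, ∀ t w, G.nodalE.mulVec w = 0 →
      G.nodalE.mulVec ((jacobian (fun y => G.nodalRHS D y t) z).mulVec w) =
        (jacobian (fun y => G.nodalRHS D y t) z).mulVec w → G.IsDegenerateMode w := by
    intro z hz t w hw h
    rw [CircuitGraph.jacobian_nodalRHS_mulVec, CircuitGraph.nodalE_mulVec_eq_self_iff] at h
    exact (hK z hz).isDegenerateMode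
      (fun d => funext fun b => CircuitGraph.nodalE_mulVec_eq_zero_iff.1 hw ⟨d, b⟩) h
  refine ⟨fun t => G.contDiff_nodalRHS D t, fun z hz t => ?_, fun Q hQ => ?_⟩
  · refine pencilHasTractabilityIndexTwo_of_idempotent CircuitGraph.nodalE_mul_self ?_ ?_
    · obtain ⟨w, hne, hw⟩ := hdeg.exists_isDegenerateMode
      refine ⟨w, hne, CircuitGraph.nodalE_mulVec_eq_zero_iff.2 fun i =>
        congrFun (hw.dyn_eq_zero i.1) i.2, ?_⟩
      rw [CircuitGraph.jacobian_nodalRHS_mulVec, CircuitGraph.nodalE_mulVec_eq_self_iff]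
      exact hw.nodalRHS_inr_eq_zero (hK z hz) 0
    · intro w y hw hy hFw hp
      have hmw := hmode z hz t w hw hFw
      rw [CircuitGraph.jacobian_nodalRHS_mulVec, CircuitGraph.jacobian_nodalRHS_mulVec,
        CircuitGraph.nodalE_mulVec_eq_self_iff] at hp
      refine hmw.eq_zero_of_velocity (hK z hz) hVloop hIcutset (t := 0) (fun i => ?_) hp
      rw [Pi.add_apply, CircuitGraph.nodalE_mulVec_eq_zero_iff.1 hy i, add_zero]
  · -- `ker E₁` does not depend on `(z, t)`, so a constant projector will do
    have hle : ∀ z ∈ Ω, ∀ t, ∀ z' ∈ Ω, ∀ t',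
        matrixKer (pencilE1 G.nodalE (jacobian (fun y => G.nodalRHS D y t) z) Q) ≤
        matrixKer (pencilE1 G.nodalE (jacobian (fun y => G.nodalRHS D y t') z') Q) := by
      intro z hz t z' hz' t'
      refine matrixKer_pencilE1_le CircuitGraph.nodalE_mul_self hQ fun w hw hFw => ?_
      have hmw := hmode z hz t w hw hFw
      rw [CircuitGraph.jacobian_nodalRHS_mulVec, CircuitGraph.jacobian_nodalRHS_mulVec]
      funext i
      rcases i with ⟨d, b⟩ | i
      · -- the differential equations do not involve the characteristics
        cases d <;> rfl
      · rw [hmw.nodalRHS_inr_eq_zero (hK z hz), hmw.nodalRHS_inr_eq_zero (hK z' hz')]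
    rcases Ω.eq_empty_or_nonempty with rfl | ⟨z₀, hz₀⟩
    · exact ⟨fun _ _ => 0, continuousOn_const, fun z hz => hz.elim⟩
    · obtain ⟨P, hP⟩ := exists_isProjectorOnto
        (matrixKer (pencilE1 G.nodalE (jacobian (fun y => G.nodalRHS D y 0) z₀) Q))
      exact ⟨fun _ _ => P, continuousOn_const, fun z hz t =>
        ⟨hP.1, hP.2.trans (le_antisymm (hle _ hz₀ _ _ hz _) (hle _ hz _ _ hz₀ _))⟩⟩
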